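/- Let $X, X'$ be random variables with values in a common standard Borel space $E$ and let $Y$ be a random variable with values in a standard Borel space $F$, all defined on the same measurable space $\Omega$ (for instance a standard probability space). Let $\mu,\nu$ be two probability measures on $\Omega$. Write $\mu^X$ for the law of $X$ under $\mu$, write $\mu^{Y\mid X=x}$ for the regular conditional law of $Y$ given $X=x$ under $\mu$, and similarly for the other random variables and for $\nu$. Let $\mathscr C(\mu^X,\mu^{X'})$ be the set of couplings of $\mu^X$ and $\mu^{X'}$, i.e. of probability measures on $E\times E$ with first marginal $\mu^X$ and second marginal $\mu^{X'}$. For probability measures $P,Q$ on the same space and $q\in(0,\infty]$, the Rényi divergence $\mathsf R_q(P\,\|\,Q)\in[0,\infty]$ is defined as follows. If $P\ll Q$, then $$\mathsf R_q(P\,\|\,Q)=\frac1{q-1}\log\int\Bigl(\frac{dP}{dQ}\Bigr)^q\,dQ\quad(q\ne 1,\infty),\qquad \mathsf R_\infty(P\,\|\,Q)=\log\Bigl\|\frac{dP}{dQ}\Bigr\|_{L^\infty(Q)},$$ and $\mathsf R_1(P\,\|\,Q)=\mathsf{KL}(P\,\|\,Q)=\int \frac{dP}{dQ}\log\frac{dP}{dQ}\,dQ$.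 If $P\not\ll Q$, then $\mathsf R_q(P\,\|\,Q)=+\infty$ for $q\ge 1$, and $\mathsf R_q(P\,\|\,Q)=\frac1{q-1}\log\int(\frac{dP}{d\lambda})^q(\frac{dQ}{d\lambda})^{1-q}\,d\lambda$ with $\lambda=P+Q$ for $q<1$ (with $\log 0=-\infty$). 1. (Shifted chain rule) It holds that $$\mathsf{KL}(\mu^Y\,\|\,\nu^Y)\le \mathsf{KL}(\mu^{X'}\,\|\,\nu^X)+\inf_{\gamma\in\mathscr C(\mu^X,\mu^{X'})}\int \mathsf{KL}(\mu^{Y\mid X=x}\,\|\,\nu^{Y\mid X=x'})\,\gamma(dx,dx').$$ 2. (Shifted composition rule) Let $q\in(0,\infty]$. If $q\in(0,1)$, assume in addition that $\mu^{X'}\ll\nu^X$. Then $$\mathsf R_q(\mu^Y\,\|\,\nu^Y)\le \mathsf R_q(\mu^{X'}\,\|\,\nu^X)+\inf_{\gamma\in\mathscr C(\mu^X,\mu^{X'})}\ \operatorname*{ess\,sup}_{(x,x')\sim\gamma}\ \mathsf R_q(\mu^{Y\mid X=x}\,\|\,\nu^{Y\mid X=x'}).$$ -/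

import Mathlib

open MeasureTheory ProbabilityTheory InformationTheory
open scoped ENNReal

noncomputable section

/-- The set of couplings of `μ` and `ν`: probability measures on the product space with first
marginal `μ` and second marginal `ν`. -/
def couplings {α β : Type*} [MeasurableSpace α] [MeasurableSpace β]
    (μ : Measure α) (ν : Measure β) : Set (Measure (α × β)) :=
  {γ | IsProbabilityMeasure γ ∧ γ.map Prod.fst = μ ∧ γ.map Prod.snd = ν}

open scoped Classical in
/-- The Rényi divergence of order `q ∈ (0, ∞]` between two probability measures, with values in the
extended reals. `ENNReal.log` is the logarithm `[0, ∞] → [-∞, ∞]`. For `q = 1` it is the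
Kullback-Leibler divergence. If `μ` is not absolutely continuous with respect to `ν`, it is `+∞`
for `q ≥ 1`, and for `q < 1` it is computed with the common dominating measure `μ + ν`. -/
def renyiDiv {α : Type*} [MeasurableSpace α] (q : ℝ≥0∞) (μ ν : Measure α) : EReal :=
  if q = 1 then (klDiv μ ν : EReal)
  else if q = ∞ then
    if μ ≪ ν then ENNReal.log (essSup (μ.rnDeriv ν) ν) else ⊤
  else if μ ≪ ν then
    (((q.toReal - 1)⁻¹ : ℝ) : EReal) * ENNReal.log (∫⁻ x, (μ.rnDeriv ν x) ^ q.toReal ∂ν)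
  else if 1 < q then ⊤
  else
    (((q.toReal - 1)⁻¹ : ℝ) : EReal) * ENNReal.log
      (∫⁻ x, (μ.rnDeriv (μ + ν) x) ^ q.toReal * (ν.rnDeriv (μ + ν) x) ^ (1 - q.toReal) ∂(μ + ν))

end

/-!
Let `γ` be a coupling of the laws of `X` and `X'` under `μ`, let `T` be the law of `X'` under `μ`
and `Q` the law of `X` under `ν`, with `T ≪ Q`. There is a probability measure `ρ` on `E × E` with
second marginal `Q` and density `dγ/dρ (x, x') = dT/dQ (x')`: divide `γ` by this density where it
is positive, and complete arbitrarily the part of `Q` that `T` does not see. The density only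
depends on `x'`, so every divergence between `γ` and `ρ` equals that between `T` and `Q`. Now draw
`y` from the law under `μ` of `Y` given `X = x` when `(x, x')` has law `γ`, and from the law under
`ν` of `Y` given `X = x'` when `(x, x')` has law `ρ`. The chain rule bounds the divergence of the
two laws of `(x, x', y)` by the right-hand side for this `γ`, and projecting to `y` can only
decrease it.
-/

section Density

variable {α β : Type*} [MeasurableSpace α] [MeasurableSpace β]

lemma map_withDensity_comp (μ : Measure α) {g : α → β} (hg : Measurable g) {f : β → ℝ≥0∞}
    (hf : Measurable f) : (μ.withDensity (f ∘ g)).map g = (μ.map g).withDensity f := by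
  ext s hs
  rw [Measure.map_apply hg hs, withDensity_apply _ (hg hs), withDensity_apply _ hs,
    setLIntegral_map hs hf hg, Function.comp_def]

lemma exists_snd_eq_and_withDensity_comp_snd_eq [Nonempty α] {γ : Measure (α × β)}
    {Q : Measure β} [SFinite Q] {r : β → ℝ≥0∞} (hr : Measurable r) (hr_top : ∀ᵐ x ∂Q, r x ≠ ∞)
    (hγ : γ.snd = Q.withDensity r) :
    ∃ ρ : Measure (α × β), ρ.snd = Q ∧ ρ.withDensity (r ∘ Prod.snd) = γ := by
  let N : Set β := {x | r x = 0}
  have hN : MeasurableSet N := hr (measurableSet_singleton 0)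
  have hγ_restrict : γ.snd = (Q.restrict Nᶜ).withDensity r := by
    rw [hγ, ← withDensity_indicator hN.compl]
    congr 1
    ext x
    by_cases hx : r x = 0 <;> simp [N, hx]
  have hγ_pos : ∀ᵐ p ∂γ, r p.2 ≠ 0 := by
    refine ae_of_ae_map measurable_snd.aemeasurable (p := fun x ↦ r x ≠ 0) ?_
    rw [← Measure.snd, hγ, ae_withDensity_iff hr]
    exact ae_of_all _ fun _ h ↦ h
  have hγ_fin : ∀ᵐ p ∂γ, r p.2 ≠ ∞ := by
    refine ae_of_ae_map measurable_snd.aemeasurable (p := fun x ↦ r x ≠ ∞) ?_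
    rw [← Measure.snd, hγ]
    exact (withDensity_absolutelyContinuous Q r).ae_le hr_top
  obtain ⟨x₀⟩ := ‹Nonempty α›
  refine ⟨γ.withDensity (r⁻¹ ∘ Prod.snd) + (Measure.dirac x₀).prod (Q.restrict N), ?_, ?_⟩
  · rw [Measure.snd_add, Measure.snd_prod, Measure.snd,
      map_withDensity_comp γ measurable_snd hr.inv, ← Measure.snd, hγ_restrict]
    conv_rhs => rw [← Measure.restrict_compl_add_restrict (μ := Q) hN]
    congr 1
    exact withDensity_inv_same hr (ae_restrict_mem hN.compl) (ae_restrict_of_ae hr_top)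
  · have h_null : ((Measure.dirac x₀).prod (Q.restrict N)).withDensity (r ∘ Prod.snd) = 0 := by
      rw [withDensity_eq_zero_iff (hr.comp measurable_snd).aemeasurable]
      refine Measure.quasiMeasurePreserving_snd.ae_eq_comp (g := r) (g' := 0) ?_
      exact ae_restrict_mem hN
    have h_inv := withDensity_inv_same (μ := γ) (f := r⁻¹ ∘ Prod.snd)
      (hr.inv.comp measurable_snd) (by simpa using hγ_fin) (by simpa using hγ_pos)
    rw [withDensity_add_measure, h_null, add_zero]
    simpa [Function.comp_def] using h_inv

lemma rnDeriv_withDensity_comp_map (ρ : Measure α) [IsFiniteMeasure ρ] {g : α → β}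
    (hg : Measurable g) {f : β → ℝ≥0∞} (hf : Measurable f) :
    (ρ.withDensity (f ∘ g)).rnDeriv ρ =ᵐ[ρ]
      ((ρ.withDensity (f ∘ g)).map g).rnDeriv (ρ.map g) ∘ g := by
  rw [map_withDensity_comp ρ hg hf]
  exact (Measure.rnDeriv_withDensity ρ (hf.comp hg)).trans
    (ae_eq_comp hg.aemeasurable (Measure.rnDeriv_withDensity (ρ.map g) hf).symm)

lemma klDiv_withDensity_comp_map (ρ : Measure α) [IsFiniteMeasure ρ] {g : α → β}
    (hg : Measurable g) {f : β → ℝ≥0∞} (hf : Measurable f)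
    [IsFiniteMeasure (ρ.withDensity (f ∘ g))] :
    klDiv ((ρ.withDensity (f ∘ g)).map g) (ρ.map g) = klDiv (ρ.withDensity (f ∘ g)) ρ := by
  have hac : ρ.withDensity (f ∘ g) ≪ ρ := withDensity_absolutelyContinuous _ _
  rw [klDiv_eq_lintegral_klFun_of_ac (hac.map hg), klDiv_eq_lintegral_klFun_of_ac hac,
    lintegral_map (by fun_prop) hg]
  exact lintegral_congr_ae ((rnDeriv_withDensity_comp_map ρ hg hf).symm.fun_comp
    fun z ↦ ENNReal.ofReal (klFun z.toReal))

lemma renyiDiv_withDensity_comp_map (q : ℝ≥0∞) (ρ : Measure α)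
    [IsFiniteMeasure ρ] {g : α → β} (hg : Measurable g) {f : β → ℝ≥0∞} (hf : Measurable f)
    [IsFiniteMeasure (ρ.withDensity (f ∘ g))] :
    renyiDiv q ((ρ.withDensity (f ∘ g)).map g) (ρ.map g) =
      renyiDiv q (ρ.withDensity (f ∘ g)) ρ := by
  have hac : ρ.withDensity (f ∘ g) ≪ ρ := withDensity_absolutelyContinuous _ _
  have hr := rnDeriv_withDensity_comp_map ρ hg hf
  have h_essSup : essSup (((ρ.withDensity (f ∘ g)).map g).rnDeriv (ρ.map g)) (ρ.map g) =
      essSup ((ρ.withDensity (f ∘ g)).rnDeriv ρ) ρ := by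
    rw [essSup_map_measure_of_measurable (Measure.measurable_rnDeriv _ _) hg.aemeasurable,
      essSup_congr_ae hr]
  have h_lintegral :
      ∫⁻ y, ((ρ.withDensity (f ∘ g)).map g).rnDeriv (ρ.map g) y ^ q.toReal ∂ρ.map g =
      ∫⁻ x, (ρ.withDensity (f ∘ g)).rnDeriv ρ x ^ q.toReal ∂ρ := by
    rw [lintegral_map (by fun_prop) hg]
    exact lintegral_congr_ae (hr.symm.fun_comp (· ^ q.toReal))
  simp only [renyiDiv, klDiv_withDensity_comp_map ρ hg hf, if_pos hac, if_pos (hac.map hg),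
    h_essSup, h_lintegral]

end Density

/-- The Hellinger integral of order `q`. Only the absolutely continuous part of `P` enters. For
`q < 1`, this is the integral of `(dP/dλ) ^ q * (dQ/dλ) ^ (1 - q)` against any dominating measure
`λ`, even when `P` is not absolutely continuous with respect to `Q`. -/
noncomputable def hellingerIntegral {α : Type*} [MeasurableSpace α] (q : ℝ) (P Q : Measure α) :
    ℝ≥0∞ :=
  ∫⁻ x, P.rnDeriv Q x ^ q ∂Q

section Hellinger

variable {α β : Type*} [MeasurableSpace α] [MeasurableSpace β] {q : ℝ}

lemma hellingerIntegral_eq_ofReal {P Q : Measure α} [SigmaFinite P]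
    (h : Integrable (fun x ↦ (P.rnDeriv Q x).toReal ^ q) Q) (hq : 0 ≤ q) :
    hellingerIntegral q P Q = ENNReal.ofReal (∫ x, (P.rnDeriv Q x).toReal ^ q ∂Q) := by
  rw [ofReal_integral_eq_lintegral_ofReal h
    (ae_of_all _ fun x ↦ Real.rpow_nonneg ENNReal.toReal_nonneg q)]
  refine lintegral_congr_ae ?_
  filter_upwards [P.rnDeriv_lt_top Q] with x hx
  rw [ENNReal.toReal_rpow, ENNReal.ofReal_toReal (ENNReal.rpow_ne_top_of_nonneg hq hx.ne)]

lemma integrable_toReal_rnDeriv_rpow {P Q : Measure α} (h : hellingerIntegral q P Q ≠ ∞) :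
    Integrable (fun x ↦ (P.rnDeriv Q x).toReal ^ q) Q := by
  simp only [ENNReal.toReal_rpow]
  exact integrable_toReal_of_lintegral_ne_top (by fun_prop) h

lemma hellingerIntegral_ne_top_of_le_one (P Q : Measure α) [IsFiniteMeasure P]
    [IsFiniteMeasure Q] (hq0 : 0 ≤ q) (hq1 : q ≤ 1) : hellingerIntegral q P Q ≠ ∞ := by
  refine ne_top_of_le_ne_top ?_ (lintegral_mono (g := fun x ↦ 1 + P.rnDeriv Q x) fun x ↦ ?_)
  · rw [lintegral_add_left measurable_const, lintegral_one]
    exact ENNReal.add_ne_top.2 ⟨measure_ne_top Q _, (Measure.lintegral_rnDeriv_lt_top P Q).ne⟩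
  · rcases le_total (P.rnDeriv Q x) 1 with hx | hx
    · exact (ENNReal.rpow_le_one hx hq0).trans le_self_add
    · exact (ENNReal.rpow_le_rpow_of_exponent_le hx hq1).trans
        ((ENNReal.rpow_one _).le.trans le_add_self)

lemma integral_comp_rnDeriv_map_le {P Q : Measure α} [IsFiniteMeasure P] [IsFiniteMeasure Q]
    (hPQ : P ≪ Q) {g : α → β} (hg : Measurable g) {f : ℝ → ℝ} (hf : StronglyMeasurable f)
    (hf_cvx : ConvexOn ℝ (Set.Ici 0) f) (hf_cont : ContinuousWithinAt f (Set.Ici 0) 0)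
    (h_int : Integrable (fun x ↦ f (P.rnDeriv Q x).toReal) Q) :
    ∫ y, f ((P.map g).rnDeriv (Q.map g) y).toReal ∂(Q.map g)
      ≤ ∫ x, f (P.rnDeriv Q x).toReal ∂Q := by
  have h_int_map := hf_cvx.integrable_comp_rnDeriv_map hPQ hg hf hf_cont h_int
  rw [integral_map hg.aemeasurable h_int_map.aestronglyMeasurable, ← integral_condExp hg.comap_le
    (f := fun x ↦ f (P.rnDeriv Q x).toReal)]
  exact integral_mono_ae (h_int_map.comp_measurable hg) integrable_condExp
    (hf_cvx.comp_rnDeriv_map_le hPQ hg hf hf_cont h_int)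

lemma hellingerIntegral_map_le {P Q : Measure α} [IsFiniteMeasure P] [IsFiniteMeasure Q]
    (hPQ : P ≪ Q) {g : α → β} (hg : Measurable g) (hq : 1 ≤ q) :
    hellingerIntegral q (P.map g) (Q.map g) ≤ hellingerIntegral q P Q := by
  by_cases htop : hellingerIntegral q P Q = ∞
  · exact htop ▸ le_top
  have hq0 : 0 ≤ q := zero_le_one.trans hq
  have h_int := integrable_toReal_rnDeriv_rpow htop
  have hf : StronglyMeasurable fun x : ℝ ↦ x ^ q := (measurable_id.pow_const q).stronglyMeasurable
  have hf_cont : ContinuousWithinAt (fun x : ℝ ↦ x ^ q) (Set.Ici 0) 0 :=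
    (Real.continuous_rpow_const hq0).continuousWithinAt
  rw [hellingerIntegral_eq_ofReal h_int hq0, hellingerIntegral_eq_ofReal
    ((convexOn_rpow hq).integrable_comp_rnDeriv_map hPQ hg hf hf_cont h_int) hq0]
  exact ENNReal.ofReal_le_ofReal
    (integral_comp_rnDeriv_map_le hPQ hg hf (convexOn_rpow hq) hf_cont h_int)

lemma hellingerIntegral_le_map_of_ac {P Q : Measure α} [IsFiniteMeasure P] [IsFiniteMeasure Q]
    (hPQ : P ≪ Q) {g : α → β} (hg : Measurable g) (hq0 : 0 ≤ q) (hq1 : q ≤ 1) :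
    hellingerIntegral q P Q ≤ hellingerIntegral q (P.map g) (Q.map g) := by
  have h_int := integrable_toReal_rnDeriv_rpow (hellingerIntegral_ne_top_of_le_one P Q hq0 hq1)
  have h_int_map := integrable_toReal_rnDeriv_rpow
    (hellingerIntegral_ne_top_of_le_one (P.map g) (Q.map g) hq0 hq1)
  rw [hellingerIntegral_eq_ofReal h_int hq0, hellingerIntegral_eq_ofReal h_int_map hq0]
  refine ENNReal.ofReal_le_ofReal ?_
  have h := integral_comp_rnDeriv_map_le hPQ hg (f := fun x ↦ -x ^ q)
    (measurable_id.pow_const q).neg.stronglyMeasurable (Real.concaveOn_rpow hq0 hq1).neg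
    (Real.continuous_rpow_const hq0).neg.continuousWithinAt h_int.neg
  rwa [integral_neg, integral_neg, neg_le_neg_iff] at h

lemma hellingerIntegral_withDensity_rnDeriv (P Q : Measure α) [SigmaFinite Q] :
    hellingerIntegral q (Q.withDensity (P.rnDeriv Q)) Q = hellingerIntegral q P Q :=
  lintegral_congr_ae
    ((Measure.rnDeriv_withDensity Q (P.measurable_rnDeriv Q)).fun_comp (· ^ q))

lemma hellingerIntegral_mono_left {P P' Q : Measure α} [IsFiniteMeasure P'] [SigmaFinite Q]
    (h : P ≤ P') (hq : 0 ≤ q) : hellingerIntegral q P Q ≤ hellingerIntegral q P' Q := by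
  have : IsFiniteMeasure P := isFiniteMeasure_of_le P' h
  rw [← Measure.sub_add_cancel_of_le h]
  refine lintegral_mono_ae ?_
  filter_upwards [Measure.rnDeriv_add' (P' - P) P Q] with x hx
  rw [hx]
  exact ENNReal.rpow_le_rpow le_add_self hq

lemma hellingerIntegral_le_map (P Q : Measure α) [IsFiniteMeasure P] [IsFiniteMeasure Q]
    {g : α → β} (hg : Measurable g) (hq0 : 0 ≤ q) (hq1 : q ≤ 1) :
    hellingerIntegral q P Q ≤ hellingerIntegral q (P.map g) (Q.map g) := by
  have := isFiniteMeasure_of_le P (Measure.withDensity_rnDeriv_le P Q)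
  rw [← hellingerIntegral_withDensity_rnDeriv]
  calc hellingerIntegral q (Q.withDensity (P.rnDeriv Q)) Q
      ≤ hellingerIntegral q ((Q.withDensity (P.rnDeriv Q)).map g) (Q.map g) :=
        hellingerIntegral_le_map_of_ac (withDensity_absolutelyContinuous _ _) hg hq0 hq1
    _ ≤ hellingerIntegral q (P.map g) (Q.map g) :=
        hellingerIntegral_mono_left (Measure.map_mono (Measure.withDensity_rnDeriv_le P Q) hg) hq0

end Hellinger

section CompProd

variable {α β : Type*} [MeasurableSpace α] [MeasurableSpace β]

lemma withDensity_compProd_withDensity (ν : Measure α) [SFinite ν] (η : Kernel α β)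
    [IsSFiniteKernel η] {r : α → ℝ≥0∞} (hr : Measurable r) [SFinite (ν.withDensity r)]
    {k : α → β → ℝ≥0∞} (hk : Measurable fun p : α × β ↦ k p.1 p.2)
    [IsSFiniteKernel (η.withDensity k)] :
    ν.withDensity r ⊗ₘ η.withDensity k = (ν ⊗ₘ η).withDensity fun p ↦ r p.1 * k p.1 p.2 := by
  have hrk : Measurable fun p : α × β ↦ r p.1 * k p.1 p.2 := (hr.comp measurable_fst).mul hk
  rw [Measure.compProd_withDensity hk]
  ext s hs
  rw [withDensity_apply _ hs, withDensity_apply _ hs, ← lintegral_indicator hs,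
    ← lintegral_indicator hs, Measure.lintegral_compProd (hk.indicator hs),
    Measure.lintegral_compProd (hrk.indicator hs),
    lintegral_withDensity_eq_lintegral_mul _ hr (hk.indicator hs).lintegral_kernel_prod_right']
  refine lintegral_congr fun x ↦ ?_
  have hk_x : Measurable fun y ↦ s.indicator (fun p ↦ k p.1 p.2) (x, y) :=
    (hk.indicator hs).comp measurable_prodMk_left
  rw [Pi.mul_apply, ← lintegral_const_mul _ hk_x]
  refine lintegral_congr fun y ↦ ?_
  by_cases hy : (x, y) ∈ s <;> simp [hy]

lemma compProd_le_smul_compProd {μ ν : Measure α} [SFinite μ] [SFinite ν] {κ η : Kernel α β}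
    [IsSFiniteKernel κ] [IsSFiniteKernel η] {c d : ℝ≥0∞} (hμν : μ ≤ c • ν)
    (hκη : ∀ᵐ x ∂μ, κ x ≤ d • η x) : μ ⊗ₘ κ ≤ (c * d) • (ν ⊗ₘ η) := by
  refine Measure.le_iff.2 fun s hs ↦ ?_
  have hη : Measurable fun x ↦ η x (Prod.mk x ⁻¹' s) := Kernel.measurable_kernel_prodMk_left hs
  rw [Measure.smul_apply, Measure.compProd_apply hs, Measure.compProd_apply hs]
  calc ∫⁻ x, κ x (Prod.mk x ⁻¹' s) ∂μ
      ≤ ∫⁻ x, d * η x (Prod.mk x ⁻¹' s) ∂μ := lintegral_mono_ae (hκη.mono fun x hx ↦ hx _)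
    _ ≤ ∫⁻ x, d * η x (Prod.mk x ⁻¹' s) ∂(c • ν) := lintegral_mono' hμν le_rfl
    _ = (c * d) • ∫⁻ x, η x (Prod.mk x ⁻¹' s) ∂ν := by
      rw [lintegral_smul_measure, lintegral_const_mul _ hη, smul_eq_mul, smul_eq_mul, mul_assoc]

variable [MeasurableSpace.CountableOrCountablyGenerated α β]

lemma rnDeriv_compProd_eq_mul_kernel (μ ν : Measure α) [IsFiniteMeasure μ] [IsFiniteMeasure ν]
    (κ η : Kernel α β) [IsFiniteKernel κ] [IsFiniteKernel η] :
    (μ ⊗ₘ κ).rnDeriv (ν ⊗ₘ η) =ᵐ[ν ⊗ₘ η]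
      fun p ↦ μ.rnDeriv ν p.1 * κ.rnDeriv η p.1 p.2 := by
  have hk : Measurable fun p : α × β ↦ κ.rnDeriv η p.1 p.2 := κ.measurable_rnDeriv η
  have h_sing_left : μ.singularPart ν ⊗ₘ η.withDensity (κ.rnDeriv η) ⟂ₘ ν ⊗ₘ η :=
    (μ.mutuallySingular_singularPart ν).compProd_of_left _ _
  have h_sing_right : μ ⊗ₘ κ.singularPart η ⟂ₘ ν ⊗ₘ η :=
    .compProd_of_right _ _ (ae_of_all _ (κ.mutuallySingular_singularPart η))
  refine (Measure.eq_rnDeriv (by fun_prop) (h_sing_right.add_left h_sing_left) ?_).symm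
  calc μ ⊗ₘ κ
      = μ ⊗ₘ κ.singularPart η + μ ⊗ₘ η.withDensity (κ.rnDeriv η) := by
        rw [← Measure.compProd_add_right, add_comm, Kernel.rnDeriv_add_singularPart]
    _ = μ ⊗ₘ κ.singularPart η + (μ.singularPart ν ⊗ₘ η.withDensity (κ.rnDeriv η) +
          ν.withDensity (μ.rnDeriv ν) ⊗ₘ η.withDensity (κ.rnDeriv η)) := by
        rw [← Measure.compProd_add_left, Measure.singularPart_add_rnDeriv]
    _ = _ := by
        rw [withDensity_compProd_withDensity ν η (μ.measurable_rnDeriv ν) hk, add_assoc]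

lemma hellingerIntegral_compProd {q : ℝ} (hq : 0 ≤ q) (μ ν : Measure α) [IsFiniteMeasure μ]
    [IsFiniteMeasure ν] (κ η : Kernel α β) [IsFiniteKernel κ] [IsFiniteKernel η] :
    hellingerIntegral q (μ ⊗ₘ κ) (ν ⊗ₘ η) =
      ∫⁻ x, μ.rnDeriv ν x ^ q * hellingerIntegral q (κ x) (η x) ∂ν := by
  have hκη : Measurable fun p : α × β ↦ κ.rnDeriv η p.1 p.2 := κ.measurable_rnDeriv η
  calc hellingerIntegral q (μ ⊗ₘ κ) (ν ⊗ₘ η)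
      = ∫⁻ p, μ.rnDeriv ν p.1 ^ q * κ.rnDeriv η p.1 p.2 ^ q ∂(ν ⊗ₘ η) := by
        refine lintegral_congr_ae ?_
        filter_upwards [rnDeriv_compProd_eq_mul_kernel μ ν κ η] with p hp
        rw [hp, ENNReal.mul_rpow_of_nonneg _ _ hq]
    _ = ∫⁻ x, μ.rnDeriv ν x ^ q * ∫⁻ y, κ.rnDeriv η x y ^ q ∂η x ∂ν := by
        rw [Measure.lintegral_compProd (by fun_prop)]
        exact lintegral_congr fun x ↦ lintegral_const_mul (μ.rnDeriv ν x ^ q)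
          ((hκη.comp measurable_prodMk_left).pow_const q)
    _ = ∫⁻ x, μ.rnDeriv ν x ^ q * hellingerIntegral q (κ x) (η x) ∂ν := by
        refine lintegral_congr fun x ↦ congrArg _ (lintegral_congr_ae ?_)
        exact Kernel.rnDeriv_eq_rnDeriv_measure.fun_comp (· ^ q)

lemma hellingerIntegral_compProd_le_mul {q : ℝ} (hq : 0 < q) {μ ν : Measure α} [IsFiniteMeasure μ]
    [IsFiniteMeasure ν] {κ η : Kernel α β} [IsFiniteKernel κ] [IsFiniteKernel η] {c : ℝ≥0∞}
    (h : ∀ᵐ x ∂μ, hellingerIntegral q (κ x) (η x) ≤ c) :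
    hellingerIntegral q (μ ⊗ₘ κ) (ν ⊗ₘ η) ≤ hellingerIntegral q μ ν * c := by
  rw [hellingerIntegral_compProd hq.le, hellingerIntegral, ← lintegral_mul_const _ (by fun_prop)]
  refine lintegral_mono_ae ?_
  filter_upwards [Measure.ae_rnDeriv_ne_zero_imp_of_ae ν h] with x hx
  rcases eq_or_ne (μ.rnDeriv ν x) 0 with h0 | h0
  · simp [h0, hq]
  · exact mul_le_mul_right (hx h0) _

lemma mul_le_hellingerIntegral_compProd {q : ℝ} (hq : 0 < q) {μ ν : Measure α} [IsFiniteMeasure μ]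
    [IsFiniteMeasure ν] {κ η : Kernel α β} [IsFiniteKernel κ] [IsFiniteKernel η] {c : ℝ≥0∞}
    (h : ∀ᵐ x ∂μ, c ≤ hellingerIntegral q (κ x) (η x)) :
    hellingerIntegral q μ ν * c ≤ hellingerIntegral q (μ ⊗ₘ κ) (ν ⊗ₘ η) := by
  rw [hellingerIntegral_compProd hq.le, hellingerIntegral, ← lintegral_mul_const _ (by fun_prop)]
  refine lintegral_mono_ae ?_
  filter_upwards [Measure.ae_rnDeriv_ne_zero_imp_of_ae ν h] with x hx
  rcases eq_or_ne (μ.rnDeriv ν x) 0 with h0 | h0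
  · simp [h0, hq]
  · exact mul_le_mul_right (hx h0) _

lemma klDiv_compProd_right (μ : Measure α) [IsFiniteMeasure μ] (κ η : Kernel α β)
    [IsFiniteKernel κ] [IsFiniteKernel η] :
    klDiv (μ ⊗ₘ κ) (μ ⊗ₘ η) = ∫⁻ x, klDiv (κ x) (η x) ∂μ := by
  by_cases h_ac : ∀ᵐ x ∂μ, κ x ≪ η x
  · have : Measurable fun p : α × β ↦ κ.rnDeriv η p.1 p.2 := κ.measurable_rnDeriv η
    have h_rnDeriv : (μ ⊗ₘ κ).rnDeriv (μ ⊗ₘ η) =ᵐ[μ ⊗ₘ η] fun p ↦ κ.rnDeriv η p.1 p.2 := by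
      filter_upwards [rnDeriv_compProd_eq_mul_kernel μ μ κ η,
        Measure.ae_eq_compProd_of_ae_eq_fst η (by fun_prop) measurable_one μ.rnDeriv_self]
        with p hp hp_one
      rw [hp, hp_one, Pi.one_apply, one_mul]
    rw [klDiv_eq_lintegral_klFun_of_ac (Measure.absolutelyContinuous_compProd_right_iff.2 h_ac),
      lintegral_congr_ae (h_rnDeriv.mono fun p hp ↦ by rw [hp]),
      Measure.lintegral_compProd (by fun_prop)]
    refine lintegral_congr_ae ?_
    filter_upwards [h_ac] with x hx
    rw [klDiv_eq_lintegral_klFun_of_ac hx]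
    exact lintegral_congr_ae (Kernel.rnDeriv_eq_rnDeriv_measure.fun_comp
      fun z ↦ ENNReal.ofReal (klFun z.toReal))
  · have h_ne : μ {x | κ x ≪ η x}ᶜ ≠ 0 := h_ac
    rw [klDiv_of_not_ac fun h ↦ h_ac (Measure.absolutelyContinuous_compProd_right_iff.1 h)]
    refine (top_le_iff.1 ?_).symm
    calc ∞ = ∫⁻ x in {x | κ x ≪ η x}ᶜ, klDiv (κ x) (η x) ∂μ := by
          rw [setLIntegral_congr_fun (Kernel.measurableSet_absolutelyContinuous κ η).compl
            fun x hx ↦ klDiv_of_not_ac hx, setLIntegral_const, ENNReal.top_mul h_ne]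
      _ ≤ ∫⁻ x, klDiv (κ x) (η x) ∂μ := setLIntegral_le_lintegral _ _

lemma klDiv_compProd_le_add {μ ν : Measure α} [IsProbabilityMeasure μ] [IsFiniteMeasure ν]
    {κ η : Kernel α β} [IsMarkovKernel κ] [IsMarkovKernel η] {c : ℝ≥0∞}
    (h : ∀ᵐ x ∂μ, klDiv (κ x) (η x) ≤ c) : klDiv (μ ⊗ₘ κ) (ν ⊗ₘ η) ≤ klDiv μ ν + c := by
  rw [klDiv_compProd_eq_add, klDiv_compProd_right]
  gcongr
  exact (lintegral_mono_ae h).trans (by simp)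

end CompProd

section EReal

lemma inv_mul_log_le_coe_iff_of_pos {d S : ℝ} (hd : 0 < d) (x : ℝ≥0∞) :
    ((d⁻¹ : ℝ) : EReal) * ENNReal.log x ≤ S ↔ x ≤ ENNReal.ofReal (Real.exp (d * S)) := by
  rw [EReal.coe_inv, ← EReal.div_eq_inv_mul,
    EReal.div_le_iff_le_mul (EReal.coe_pos.2 hd) (EReal.coe_ne_top d), ← EReal.coe_mul,
    ← EReal.exp_coe, ← ENNReal.log_le_log_iff, EReal.log_exp]

lemma inv_mul_log_le_coe_iff_of_neg {d S : ℝ} (hd : d < 0) (x : ℝ≥0∞) :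
    ((d⁻¹ : ℝ) : EReal) * ENNReal.log x ≤ S ↔ ENNReal.ofReal (Real.exp (d * S)) ≤ x := by
  have h_eq : ((d⁻¹ : ℝ) : EReal) * ENNReal.log x = (((-d)⁻¹ : ℝ) : EReal) * ENNReal.log x⁻¹ := by
    rw [ENNReal.log_inv, inv_neg, EReal.coe_neg, neg_mul_neg]
  rw [h_eq, inv_mul_log_le_coe_iff_of_pos (neg_pos.2 hd), neg_mul, Real.exp_neg,
    ENNReal.ofReal_inv_of_pos (Real.exp_pos _), ENNReal.inv_le_inv]

lemma le_add_of_forall_le_coe {a b c : EReal} (ha : a ≠ ⊥) (hb : b ≠ ⊥)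
    (h : ∀ A B : ℝ, a ≤ A → b ≤ B → c ≤ A + B) : c ≤ a + b := by
  induction a with
  | bot => exact absurd rfl ha
  | top => exact (EReal.top_add_of_ne_bot hb).symm ▸ le_top
  | coe a =>
    induction b with
    | bot => exact absurd rfl hb
    | top => exact (EReal.add_top_of_ne_bot ha).symm ▸ le_top
    | coe b => exact h a b le_rfl le_rfl

lemma le_add_biInf_of_forall_le_add {ι : Type*} {s : Set ι} {a b : EReal} {f : ι → EReal}
    (hb : b ≠ ⊥) (hf : ⨅ i ∈ s, f i ≠ ⊥) (h : ∀ i ∈ s, a ≤ b + f i) : a ≤ b + ⨅ i ∈ s, f i := by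
  refine le_add_of_forall_le_coe hb hf fun A B hA hB ↦ ?_
  have h_sub : a - A ≤ ⨅ i ∈ s, f i := le_iInf₂ fun i hi ↦ by
    rw [EReal.sub_le_iff_le_add (.inl (EReal.coe_ne_bot A)) (.inl (EReal.coe_ne_top A)), add_comm]
    exact (h i hi).trans (add_le_add_left hA _)
  rw [add_comm,
    ← EReal.sub_le_iff_le_add (.inl (EReal.coe_ne_bot A)) (.inl (EReal.coe_ne_top A))]
  exact h_sub.trans hB

end EReal

section RenyiDiv

variable {α β : Type*} [MeasurableSpace α] [MeasurableSpace β] {q : ℝ≥0∞} {S : ℝ}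

lemma lintegral_rnDeriv_add_rpow_mul (P Q : Measure α) [SigmaFinite P] [SigmaFinite Q]
    {q : ℝ} (hq0 : 0 ≤ q) (hq1 : q < 1) :
    ∫⁻ x, P.rnDeriv (P + Q) x ^ q * Q.rnDeriv (P + Q) x ^ (1 - q) ∂(P + Q) =
      hellingerIntegral q P Q := by
  have hac : Q ≪ P + Q := Measure.AbsolutelyContinuous.rfl.add_right' P
  have h_div : hellingerIntegral q P Q =
      ∫⁻ x, (P.rnDeriv (P + Q) x / Q.rnDeriv (P + Q) x) ^ q ∂Q :=
    lintegral_congr_ae ((P.rnDeriv_eq_div_rnDeriv_add Q).fun_comp (· ^ q))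
  rw [h_div, ← lintegral_rnDeriv_mul hac
      (f := fun x ↦ (P.rnDeriv (P + Q) x / Q.rnDeriv (P + Q) x) ^ q) (by fun_prop)]
  refine lintegral_congr_ae ?_
  filter_upwards [Q.rnDeriv_lt_top (P + Q)] with x hx
  rcases eq_or_ne (Q.rnDeriv (P + Q) x) 0 with h0 | h0
  · simp [h0, hq1]
  · rw [ENNReal.div_rpow_of_nonneg _ _ hq0, div_eq_mul_inv, mul_left_comm, ← ENNReal.rpow_neg,
      sub_eq_add_neg, ENNReal.rpow_add _ _ h0 hx.ne, ENNReal.rpow_one]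

lemma renyiDiv_one (P Q : Measure α) : renyiDiv 1 P Q = klDiv P Q := if_pos rfl

lemma renyiDiv_one_le_coe_iff {P Q : Measure α} :
    renyiDiv 1 P Q ≤ S ↔ 0 ≤ S ∧ klDiv P Q ≤ ENNReal.ofReal S := by
  rw [renyiDiv_one]
  refine ⟨fun h ↦ ?_, fun ⟨hS, h⟩ ↦ ?_⟩
  · have hS : 0 ≤ S := EReal.coe_nonneg.1 ((EReal.coe_ennreal_nonneg _).trans h)
    exact ⟨hS, EReal.coe_ennreal_le_coe_ennreal_iff.1 (by simpa [hS] using h)⟩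
  · simpa [hS] using EReal.coe_ennreal_le_coe_ennreal_iff.2 h

lemma absolutelyContinuous_of_renyiDiv_ne_top {P Q : Measure α} (hq : 1 ≤ q)
    (h : renyiDiv q P Q ≠ ⊤) : P ≪ Q := by
  by_contra hPQ
  apply h
  rcases hq.eq_or_lt with rfl | hq
  · rw [renyiDiv_one, klDiv_of_not_ac hPQ, EReal.coe_ennreal_top]
  · by_cases hq_top : q = ∞ <;> simp [renyiDiv, hq, hq.ne', hq_top, hPQ]

lemma renyiDiv_le_coe_iff_of_lt_one {P Q : Measure α} [SigmaFinite P] [SigmaFinite Q]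
    (hq : q < 1) : renyiDiv q P Q ≤ S ↔
      ENNReal.ofReal (Real.exp ((q.toReal - 1) * S)) ≤ hellingerIntegral q.toReal P Q := by
  have hq1 : q.toReal < 1 := ENNReal.toReal_strict_mono ENNReal.one_ne_top hq
  rw [← inv_mul_log_le_coe_iff_of_neg (sub_neg.2 hq1), renyiDiv, if_neg hq.ne, if_neg hq.ne_top,
    if_neg hq.not_gt, lintegral_rnDeriv_add_rpow_mul P Q ENNReal.toReal_nonneg hq1,
    ← hellingerIntegral, ite_self]

lemma renyiDiv_le_coe_iff_of_one_lt {P Q : Measure α} (hq : 1 < q) (hq_top : q ≠ ∞) :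
    renyiDiv q P Q ≤ S ↔ P ≪ Q ∧
      hellingerIntegral q.toReal P Q ≤ ENNReal.ofReal (Real.exp ((q.toReal - 1) * S)) := by
  have hq1 : 1 < q.toReal := ENNReal.toReal_strict_mono hq_top hq
  rw [← inv_mul_log_le_coe_iff_of_pos (sub_pos.2 hq1), renyiDiv,
    if_neg hq.ne', if_neg hq_top, if_pos hq, ← hellingerIntegral]
  by_cases hPQ : P ≪ Q <;> simp [hPQ]

lemma essSup_rnDeriv_le_iff {P Q : Measure α} [SigmaFinite P] [SigmaFinite Q] (hPQ : P ≪ Q)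
    {c : ℝ≥0∞} : essSup (P.rnDeriv Q) Q ≤ c ↔ P ≤ c • Q := by
  refine ⟨fun h ↦ ?_, fun h ↦ ?_⟩
  · rw [← Measure.withDensity_rnDeriv_eq P Q hPQ, ← withDensity_const]
    exact withDensity_mono ((ENNReal.ae_le_essSup _).mono fun x hx ↦ hx.trans h)
  · refine essSup_le_of_ae_le c (ae_le_of_forall_setLIntegral_le_of_sigmaFinite
      (Measure.measurable_rnDeriv P Q) fun s _ _ ↦ ?_)
    rw [setLIntegral_const]
    exact (Measure.setLIntegral_rnDeriv_le s).trans (h s)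

lemma renyiDiv_top_le_coe_iff {P Q : Measure α} [SigmaFinite P] [SigmaFinite Q] :
    renyiDiv ∞ P Q ≤ S ↔ P ≤ ENNReal.ofReal (Real.exp S) • Q := by
  by_cases hPQ : P ≪ Q
  · rw [← essSup_rnDeriv_le_iff hPQ, ← EReal.exp_coe, ← ENNReal.log_le_log_iff, EReal.log_exp]
    simp [renyiDiv, hPQ]
  · have h_not_le : ¬ P ≤ ENNReal.ofReal (Real.exp S) • Q := fun h ↦
      hPQ ((Measure.absolutelyContinuous_of_le h).trans (Measure.smul_absolutelyContinuous))
    simp [renyiDiv, hPQ, h_not_le]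

theorem renyiDiv_map_le (P Q : Measure α) [IsFiniteMeasure P] [IsFiniteMeasure Q] {g : α → β}
    (hg : Measurable g) : renyiDiv q (P.map g) (Q.map g) ≤ renyiDiv q P Q := by
  refine EReal.le_of_forall_lt_iff_le.1 fun S hS ↦ ?_
  replace hS := hS.le
  rcases lt_trichotomy q 1 with hq | rfl | hq
  · have hq1 : q.toReal < 1 := ENNReal.toReal_strict_mono ENNReal.one_ne_top hq
    rw [renyiDiv_le_coe_iff_of_lt_one hq] at hS ⊢
    exact hS.trans (hellingerIntegral_le_map P Q hg ENNReal.toReal_nonneg hq1.le)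
  · rw [renyiDiv_one] at hS ⊢
    exact (EReal.coe_ennreal_le_coe_ennreal_iff.2 (klDiv_map_le P Q hg)).trans hS
  rcases eq_or_ne q ∞ with rfl | hq_top
  · rw [renyiDiv_top_le_coe_iff] at hS ⊢
    rw [← Measure.map_smul]
    exact Measure.map_mono hS hg
  · have hq1 : 1 < q.toReal := ENNReal.toReal_strict_mono hq_top hq
    rw [renyiDiv_le_coe_iff_of_one_lt hq hq_top] at hS ⊢
    exact ⟨hS.1.map hg, (hellingerIntegral_map_le hS.1 hg hq1.le).trans hS.2⟩

lemma renyiDiv_self (P : Measure α) [IsProbabilityMeasure P] : renyiDiv q P P = 0 := by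
  have h_lintegral (p : ℝ) : ∫⁻ x, P.rnDeriv P x ^ p ∂P = 1 :=
    (lintegral_congr_ae (P.rnDeriv_self.fun_comp (· ^ p))).trans (by simp)
  have h_essSup : essSup (P.rnDeriv P) P = 1 := by
    rw [essSup_congr_ae P.rnDeriv_self]
    exact essSup_const _ (NeZero.ne P)
  simp [renyiDiv, h_lintegral, h_essSup, Measure.AbsolutelyContinuous.rfl]

theorem renyiDiv_nonneg (P Q : Measure α) [IsProbabilityMeasure P] [IsProbabilityMeasure Q] :
    0 ≤ renyiDiv q P Q := by
  simpa [Measure.map_const, renyiDiv_self] using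
    renyiDiv_map_le (q := q) P Q (measurable_const (a := ()))

end RenyiDiv

section Chain

variable {α β : Type*} [MeasurableSpace α] [MeasurableSpace β] {q : ℝ≥0∞}

lemma essSup_renyiDiv_nonneg (μ : Measure α) [NeZero μ] (P Q : α → Measure β)
    [∀ x, IsProbabilityMeasure (P x)] [∀ x, IsProbabilityMeasure (Q x)] :
    0 ≤ essSup (fun x ↦ renyiDiv q (P x) (Q x)) μ := by
  obtain ⟨x, hx⟩ := (ae_le_essSup (f := fun x ↦ renyiDiv q (P x) (Q x)) (μ := μ)).exists
  exact (renyiDiv_nonneg _ _).trans hx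

variable [MeasurableSpace.CountableOrCountablyGenerated α β]

lemma renyiDiv_compProd_le_coe (hq : 0 < q) {μ ν : Measure α} [IsProbabilityMeasure μ]
    [IsFiniteMeasure ν] {κ η : Kernel α β} [IsMarkovKernel κ] [IsMarkovKernel η] {A S : ℝ}
    (hμν : renyiDiv q μ ν ≤ A) (hκη : ∀ᵐ x ∂μ, renyiDiv q (κ x) (η x) ≤ S) :
    renyiDiv q (μ ⊗ₘ κ) (ν ⊗ₘ η) ≤ (A + S : ℝ) := by
  have h_exp (d : ℝ) : ENNReal.ofReal (Real.exp (d * (A + S))) =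
      ENNReal.ofReal (Real.exp (d * A)) * ENNReal.ofReal (Real.exp (d * S)) := by
    rw [mul_add, Real.exp_add, ENNReal.ofReal_mul (Real.exp_nonneg _)]
  rcases lt_trichotomy q 1 with hq1 | rfl | hq1
  · have hq0 : 0 < q.toReal := ENNReal.toReal_pos hq.ne' hq1.ne_top
    simp only [renyiDiv_le_coe_iff_of_lt_one hq1] at hμν hκη ⊢
    rw [h_exp]
    exact (mul_le_mul_left hμν _).trans (mul_le_hellingerIntegral_compProd hq0 hκη)
  · simp only [renyiDiv_one_le_coe_iff, Filter.eventually_and, Filter.eventually_const] at hμν hκη ⊢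
    rw [ENNReal.ofReal_add hμν.1 hκη.1]
    exact ⟨add_nonneg hμν.1 hκη.1,
      (klDiv_compProd_le_add hκη.2).trans (add_le_add_left hμν.2 _)⟩
  rcases eq_or_ne q ∞ with rfl | hq_top
  · simp only [renyiDiv_top_le_coe_iff] at hμν hκη ⊢
    rw [← one_mul (A + S), h_exp, one_mul, one_mul]
    exact compProd_le_smul_compProd hμν hκη
  · have hq0 : 0 < q.toReal := ENNReal.toReal_pos hq.ne' hq_top
    simp only [renyiDiv_le_coe_iff_of_one_lt hq1 hq_top, Filter.eventually_and] at hμν hκη ⊢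
    rw [h_exp]
    exact ⟨hμν.1.compProd hκη.1,
      (hellingerIntegral_compProd_le_mul hq0 hκη.2).trans (mul_le_mul_left hμν.2 _)⟩

theorem renyiDiv_compProd_le (hq : 0 < q) (μ ν : Measure α) [IsProbabilityMeasure μ]
    [IsProbabilityMeasure ν] (κ η : Kernel α β) [IsMarkovKernel κ] [IsMarkovKernel η] :
    renyiDiv q (μ ⊗ₘ κ) (ν ⊗ₘ η) ≤
      renyiDiv q μ ν + essSup (fun x ↦ renyiDiv q (κ x) (η x)) μ := by
  refine le_add_of_forall_le_coe (ne_bot_of_le_ne_bot EReal.zero_ne_bot (renyiDiv_nonneg μ ν))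
    (ne_bot_of_le_ne_bot EReal.zero_ne_bot (essSup_renyiDiv_nonneg μ κ η)) fun A S hA hS ↦ ?_
  have hκη : ∀ᵐ x ∂μ, renyiDiv q (κ x) (η x) ≤ S := by
    filter_upwards [ae_le_essSup (f := fun x ↦ renyiDiv q (κ x) (η x))] with x hx
    exact hx.trans hS
  exact_mod_cast renyiDiv_compProd_le_coe hq hA hκη

end Chain

section Shifted

variable {α β : Type*} [MeasurableSpace α] [MeasurableSpace β] {q : ℝ≥0∞}

lemma exists_snd_eq_and_renyiDiv_eq [Nonempty α] (γ : Measure (α × β)) [IsFiniteMeasure γ]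
    {Q : Measure β} [IsProbabilityMeasure Q] (hγQ : γ.snd ≪ Q) :
    ∃ ρ : Measure (α × β), IsProbabilityMeasure ρ ∧ ρ.snd = Q ∧
      ∀ q, renyiDiv q γ ρ = renyiDiv q γ.snd Q := by
  have hr : Measurable (γ.snd.rnDeriv Q) := Measure.measurable_rnDeriv _ _
  obtain ⟨ρ, hρQ, hργ⟩ := exists_snd_eq_and_withDensity_comp_snd_eq hr
    (Measure.rnDeriv_ne_top γ.snd Q) (Measure.withDensity_rnDeriv_eq γ.snd Q hγQ).symm
  have : IsProbabilityMeasure (ρ.map Prod.snd) := by rwa [← Measure.snd, hρQ]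
  have := ρ.isProbabilityMeasure_of_map Prod.snd
  have : IsFiniteMeasure (ρ.withDensity (γ.snd.rnDeriv Q ∘ Prod.snd)) := by rwa [hργ]
  refine ⟨ρ, inferInstance, hρQ, fun q ↦ ?_⟩
  have h := renyiDiv_withDensity_comp_map q ρ measurable_snd hr
  rw [hργ, ← Measure.snd, ← Measure.snd, hρQ] at h
  exact h.symm

lemma comap_comp_eq_comp_map {δ : Type*} [MeasurableSpace δ] (μ : Measure δ) (κ : Kernel α β)
    {g : δ → α} (hg : Measurable g) : κ.comap g hg ∘ₘ μ = κ ∘ₘ μ.map g := by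
  rw [← Kernel.comp_deterministic_eq_comap, ← Measure.comp_assoc,
    Measure.deterministic_comp_eq_map]

lemma klDiv_comp_le_compProd (μ ν : Measure α) [IsFiniteMeasure μ] [IsFiniteMeasure ν]
    (κ η : Kernel α β) [IsFiniteKernel κ] [IsFiniteKernel η] :
    klDiv (κ ∘ₘ μ) (η ∘ₘ ν) ≤ klDiv (μ ⊗ₘ κ) (ν ⊗ₘ η) := by
  rw [← Measure.snd_compProd, ← Measure.snd_compProd]
  exact klDiv_map_le _ _ measurable_snd

lemma renyiDiv_comp_le_compProd (μ ν : Measure α) [IsFiniteMeasure μ] [IsFiniteMeasure ν]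
    (κ η : Kernel α β) [IsFiniteKernel κ] [IsFiniteKernel η] :
    renyiDiv q (κ ∘ₘ μ) (η ∘ₘ ν) ≤ renyiDiv q (μ ⊗ₘ κ) (ν ⊗ₘ η) := by
  rw [← Measure.snd_compProd, ← Measure.snd_compProd]
  exact renyiDiv_map_le _ _ measurable_snd

variable [MeasurableSpace.CountablyGenerated β] {P T Q : Measure α} [IsProbabilityMeasure Q]
  (κ η : Kernel α β) [IsMarkovKernel κ] [IsMarkovKernel η] {γ : Measure (α × α)}

theorem klDiv_comp_le_add_lintegral_of_mem_couplings (hγ : γ ∈ couplings P T) :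
    klDiv (κ ∘ₘ P) (η ∘ₘ Q) ≤ klDiv T Q + ∫⁻ p, klDiv (κ p.1) (η p.2) ∂γ := by
  obtain ⟨_, rfl, rfl⟩ := hγ
  by_cases hTQ : γ.map Prod.snd ≪ Q
  swap
  · rw [klDiv_of_not_ac hTQ, top_add]
    exact le_top
  have := nonempty_of_isProbabilityMeasure Q
  obtain ⟨ρ, _, rfl, hρ⟩ := exists_snd_eq_and_renyiDiv_eq γ hTQ
  have h_kl : klDiv γ ρ = klDiv γ.snd ρ.snd := by
    simpa [renyiDiv_one] using hρ 1
  calc klDiv (κ ∘ₘ γ.fst) (η ∘ₘ ρ.snd)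
      = klDiv (κ.comap Prod.fst measurable_fst ∘ₘ γ) (η.comap Prod.snd measurable_snd ∘ₘ ρ) := by
        rw [comap_comp_eq_comp_map, comap_comp_eq_comp_map, Measure.fst, Measure.snd]
    _ ≤ klDiv (γ ⊗ₘ κ.comap Prod.fst measurable_fst) (ρ ⊗ₘ η.comap Prod.snd measurable_snd) :=
        klDiv_comp_le_compProd _ _ _ _
    _ = klDiv γ.snd ρ.snd + ∫⁻ p, klDiv (κ p.1) (η p.2) ∂γ := by
        rw [klDiv_compProd_eq_add, klDiv_compProd_right, h_kl]
        rfl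

theorem renyiDiv_comp_le_add_essSup_of_mem_couplings (hq : 0 < q) (hTQ : q < 1 → T ≪ Q)
    (hγ : γ ∈ couplings P T) :
    renyiDiv q (κ ∘ₘ P) (η ∘ₘ Q) ≤
      renyiDiv q T Q + essSup (fun p ↦ renyiDiv q (κ p.1) (η p.2)) γ := by
  obtain ⟨_, rfl, rfl⟩ := hγ
  by_cases h_top : 1 ≤ q ∧ renyiDiv q (γ.map Prod.snd) Q = ⊤
  · rw [h_top.2, EReal.top_add_of_ne_bot (ne_bot_of_le_ne_bot EReal.zero_ne_bot
      (essSup_renyiDiv_nonneg γ (fun p ↦ κ p.1) (fun p ↦ η p.2)))]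
    exact le_top
  replace hTQ : γ.snd ≪ Q := (lt_or_ge q 1).elim hTQ fun hq1 ↦
    absolutelyContinuous_of_renyiDiv_ne_top hq1 fun h ↦ h_top ⟨hq1, h⟩
  have := nonempty_of_isProbabilityMeasure Q
  obtain ⟨ρ, _, rfl, hρ⟩ := exists_snd_eq_and_renyiDiv_eq γ hTQ
  calc renyiDiv q (κ ∘ₘ γ.fst) (η ∘ₘ ρ.snd)
      = renyiDiv q (κ.comap Prod.fst measurable_fst ∘ₘ γ)
          (η.comap Prod.snd measurable_snd ∘ₘ ρ) := by
        rw [comap_comp_eq_comp_map, comap_comp_eq_comp_map, Measure.fst, Measure.snd]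
    _ ≤ renyiDiv q (γ ⊗ₘ κ.comap Prod.fst measurable_fst)
          (ρ ⊗ₘ η.comap Prod.snd measurable_snd) := renyiDiv_comp_le_compProd _ _ _ _
    _ ≤ renyiDiv q γ ρ + essSup (fun p ↦ renyiDiv q (κ p.1) (η p.2)) γ :=
        renyiDiv_compProd_le hq _ _ _ _
    _ = renyiDiv q γ.snd ρ.snd + essSup (fun p ↦ renyiDiv q (κ p.1) (η p.2)) γ := by rw [hρ]

end Shifted

theorem theorem3p1_general {Ω E F : Type*} [MeasurableSpace Ω] [MeasurableSpace E]
    [MeasurableSpace F] [StandardBorelSpace F] [Nonempty F]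
    (μ ν : Measure Ω) [IsProbabilityMeasure μ] [IsProbabilityMeasure ν]
    (X X' : Ω → E) (Y : Ω → F)
    (hX : Measurable X) (hX' : Measurable X') (hY : Measurable Y) :
    (klDiv (μ.map Y) (ν.map Y) ≤
      klDiv (μ.map X') (ν.map X) +
        ⨅ γ ∈ couplings (μ.map X) (μ.map X'),
          ∫⁻ p, klDiv (condDistrib Y X μ p.1) (condDistrib Y X ν p.2) ∂γ) ∧
    (∀ q : ℝ≥0∞, 0 < q → (q < 1 → μ.map X' ≪ ν.map X) →
      renyiDiv q (μ.map Y) (ν.map Y) ≤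
        renyiDiv q (μ.map X') (ν.map X) +
          ⨅ γ ∈ couplings (μ.map X) (μ.map X'),
            essSup (fun p : E × E =>
              renyiDiv q (condDistrib Y X μ p.1) (condDistrib Y X ν p.2)) γ) := by
  have := Measure.isProbabilityMeasure_map (μ := μ) hX'.aemeasurable
  have := Measure.isProbabilityMeasure_map (μ := ν) hX.aemeasurable
  rw [← condDistrib_comp_map (μ := μ) hX.aemeasurable hY.aemeasurable,
    ← condDistrib_comp_map (μ := ν) hX.aemeasurable hY.aemeasurable]
  refine ⟨?_, fun q hq hac ↦ ?_⟩
  · simp_rw [ENNReal.add_iInf]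
    exact le_iInf₂ fun γ hγ ↦ klDiv_comp_le_add_lintegral_of_mem_couplings _ _ hγ
  · refine le_add_biInf_of_forall_le_add
      (ne_bot_of_le_ne_bot EReal.zero_ne_bot (renyiDiv_nonneg _ _))
      (ne_bot_of_le_ne_bot EReal.zero_ne_bot (le_iInf₂ fun γ hγ ↦ ?_))
      fun γ hγ ↦ renyiDiv_comp_le_add_essSup_of_mem_couplings _ _ hq hac hγ
    have := hγ.1
    exact essSup_renyiDiv_nonneg γ _ _

theorem theorem3p1 {Ω E F : Type*} [MeasurableSpace Ω]
    [MeasurableSpace E] [StandardBorelSpace E]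
    [MeasurableSpace F] [StandardBorelSpace F] [Nonempty F]
    (μ ν : Measure Ω) [IsProbabilityMeasure μ] [IsProbabilityMeasure ν]
    (X X' : Ω → E) (Y : Ω → F)
    (hX : Measurable X) (hX' : Measurable X') (hY : Measurable Y) :
    (klDiv (μ.map Y) (ν.map Y) ≤
      klDiv (μ.map X') (ν.map X) +
        ⨅ γ ∈ couplings (μ.map X) (μ.map X'),
          ∫⁻ p, klDiv (condDistrib Y X μ p.1) (condDistrib Y X ν p.2) ∂γ) ∧
    (∀ q : ℝ≥0∞, 0 < q → (q < 1 → μ.map X' ≪ ν.map X) →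
      renyiDiv q (μ.map Y) (ν.map Y) ≤
        renyiDiv q (μ.map X') (ν.map X) +
          ⨅ γ ∈ couplings (μ.map X) (μ.map X'),
            essSup (fun p : E × E =>
              renyiDiv q (condDistrib Y X μ p.1) (condDistrib Y X ν p.2)) γ) :=
  theorem3p1_general μ ν X X' Y hX hX' hY
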